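/- Let $\mathcal X,\Phi$ be Polish spaces with their Borel $\sigma$-algebras, $\mathcal Y=\mathcal X\times\Phi$, and let $\mathcal I$ be a measurable space. Let $\nu$ be a probability measure on $\mathcal X$, let $(y,\gamma,A)\mapsto P_\gamma(y,A)$ be a Markov transition kernel from $\mathcal Y\times\mathcal I$ to $\mathcal Y$, and for each $\gamma\in\mathcal I$ let $\pi_\gamma$ be a probability measure on $\mathcal Y$ that is invariant for $P_\gamma$ and satisfies $\pi_\gamma(B\times\Phi)=\nu(B)$ for all measurable $B\subseteq\mathcal X$. **The chain.** Let $\beta>0$, $y_0\in\mathcal Y$, $\gamma_0\in\mathcal I$, and let $(Y_n,\Gamma_n)_{n\ge0}$ be random variables on a probability space with values in $\mathcal Y\times\mathcal I$ such that, with $\mathcal F_n=\sigma(Y_0,\dots,Y_n,\Gamma_0,\dots,\Gamma_n)$: - $(Y_0,\Gamma_0)=(y_0,\gamma_0)$; - $\mathbb P[Y_{n+1}\in B\mid\mathcal F_n]=P_{\Gamma_n}(Y_n,B)$ almost surely for all $n\ge 0$ and all measurable $B\subseteq\mathcal Y$; - $\Gamma_n=U_n(Y_0,\dots,Y_n,\Gamma_0,\dots,\Gamma_{n-1})$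 with measurable functions $U_n$; - (AIR scheme) with $T_m=\sum_{j=1}^m\lceil j^\beta\rceil$, $T_0=0$, one has $\Gamma_{i_1}=\Gamma_{i_2}$ whenever $T_j\le i_1,i_2<T_{j+1}$ for some $j\ge0$. Write $Y_n=(X_n,\phi_n)$. **Distance-like functions.** A function $d:\mathcal Y\times\mathcal Y\to[0,\infty)$ is distance-like if it is symmetric, lower semicontinuous, and $d(x,y)=0$ if and only if $x=y$. For a distance-like function $\rho$, put $\mathcal W_\rho(\mu_1,\mu_2)=\inf_\xi\int\rho\,d\xi$, the infimum over all couplings $\xi$ of $\mu_1,\mu_2$, and, for a kernel $Q$ on $\mathcal Y$, $\tau_\rho(Q)=\sup_{y_1\ne y_2}\mathcal W_\rho(Q(y_1,\cdot),Q(y_2,\cdot))/\rho(y_1,y_2)$. **Assumptions.** Let $d$ be a distance-like function on $\mathcal Y$ with $d\le1$. Let $V:\mathcal Y\to[1,\infty)$ be lower semicontinuous, and suppose that there are $\kappa\in(0,1)$ and $b\in(0,\infty)$ such that $P_\gamma V(y)\le\kappa V(y)+b$ for all $\gamma\in\mathcal I$, $y\in\mathcal Y$. Let $p>2$ and $$\rho(y_1,y_2)=\widetilde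 d_{1/p}(y_1,y_2)=\sqrt{d(y_1,y_2)\,\bigl(1+V^{1/p}(y_1)+V^{1/p}(y_2)\bigr)},$$ and suppose that there are an integer $k_0\ge1$, $\tau\in[0,1)$ and $M\in(0,\infty)$ such that $\tau_\rho(P_\gamma^{k_0})\le\tau$ and $\tau_\rho(P_\gamma)\le M$ for all $\gamma\in\mathcal I$. Let $f:\mathcal X\to\mathbb R$ be measurable and such that the function $h(x,\phi)=f(x)$ on $\mathcal Y$ satisfies $|h|\le V^{1/p}$ and, for some $L\in(0,\infty)$, $|h(y_1)-h(y_2)|\le L\,\rho(y_1,y_2)$ for all $y_1,y_2\in\mathcal Y$. **Conclusion.** Then $f$ is $\nu$-integrable, and for every $\varepsilon>\max\bigl\{0,\frac1{1+\beta}+\frac1p-\frac12\bigr\}$, almost surely, $$\lim_{n\to\infty}\frac1{n^{1/2+\varepsilon}}\sum_{j=1}^n\bigl(f(X_j)-\nu(f)\bigr)=0 .$$ -/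

import Mathlib

open MeasureTheory ProbabilityTheory Filter Topology
open scoped ENNReal

noncomputable section

namespace AirMCMC

/-! ### Distance-like and Wasserstein-like functions -/

/-- A distance-like function: nonnegative, symmetric, vanishing exactly on the diagonal, and lower
semicontinuous for the product topology. -/
structure IsDistanceLike {A : Type*} [TopologicalSpace A] (d : A → A → ℝ) : Prop where
  nonneg : ∀ x y, 0 ≤ d x y
  symm : ∀ x y, d x y = d y x
  eq_zero_iff : ∀ x y, d x y = 0 ↔ x = y
  lowerSemicontinuous : LowerSemicontinuous (fun z : A × A => d z.1 z.2)

/-- `ξ` is a coupling of `μ₁` and `μ₂`. -/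
def IsCoupling {A : Type*} [MeasurableSpace A] (ξ : Measure (A × A)) (μ₁ μ₂ : Measure A) : Prop :=
  ξ.map Prod.fst = μ₁ ∧ ξ.map Prod.snd = μ₂

/-- The Wasserstein-like function `𝒲(μ₁, μ₂) = inf_ξ ∫ d(x, y) ξ(dx, dy)`, the infimum being over
all couplings of `μ₁` and `μ₂`; it takes values in `[0, ∞]`. -/
def wassersteinLike {A : Type*} [MeasurableSpace A] (d : A → A → ℝ) (μ₁ μ₂ : Measure A) : ℝ≥0∞ :=
  ⨅ (ξ : Measure (A × A)) (_ : IsCoupling ξ μ₁ μ₂), ∫⁻ z, ENNReal.ofReal (d z.1 z.2) ∂ξ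

/-- The Wasserstein contraction coefficient
`τ(κ) = sup_{y₁ ≠ y₂} 𝒲(κ(y₁, ·), κ(y₂, ·)) / d(y₁, y₂)`. -/
def contractionCoeff {A : Type*} [MeasurableSpace A] (d : A → A → ℝ) (κ : Kernel A A) : ℝ≥0∞ :=
  ⨆ (y₁ : A) (y₂ : A) (_ : y₁ ≠ y₂),
    wassersteinLike d (κ y₁) (κ y₂) / ENNReal.ofReal (d y₁ y₂)

/-- `ψ` is Lipschitz with respect to `d`, with some constant `L ∈ (0, ∞)`. -/
def IsLipschitzWrt {A : Type*} (d : A → A → ℝ) (ψ : A → ℝ) : Prop :=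
  ∃ L : ℝ, 0 < L ∧ ∀ x y, |ψ x - ψ y| ≤ L * d x y

/-- `d̃_q(y₁, y₂) = √(d(y₁, y₂) (1 + V(y₁)^q + V(y₂)^q))`. -/
def weightedDist {A : Type*} (d : A → A → ℝ) (V : A → ℝ) (q : ℝ) (y₁ y₂ : A) : ℝ :=
  Real.sqrt (d y₁ y₂ * (1 + V y₁ ^ q + V y₂ ^ q))

/-! ### Families of kernels -/

/-- The member `P_γ` of a jointly measurable family of kernels `(y, γ, A) ↦ P_γ(y, A)`. -/
def kernelAt {Y I : Type*} [MeasurableSpace Y] [MeasurableSpace I]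
    (P : Kernel (Y × I) Y) (γ : I) : Kernel Y Y :=
  P.sectL γ

/-- `V : Y → [1, ∞)` is a common Lyapunov function of all the kernels `P_γ`:
`P_γ V ≤ κ V + b` with constants `κ ∈ (0, 1)` and `b ∈ (0, ∞)` that do not depend on `γ`. -/
def IsCommonLyapunov {Y I : Type*} [MeasurableSpace Y] [MeasurableSpace I]
    (P : Kernel (Y × I) Y) (V : Y → ℝ) : Prop :=
  (∀ y, 1 ≤ V y) ∧
  ∃ κ b : ℝ, 0 < κ ∧ κ < 1 ∧ 0 < b ∧
    ∀ γ y, ∫⁻ y', ENNReal.ofReal (V y') ∂(kernelAt P γ y) ≤ ENNReal.ofReal (κ * V y + b)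

/-- Uniform contraction with respect to `d`: there are `k₀ ≥ 1`, `τ ∈ [0, 1)` and `M ∈ (0, ∞)`
with `τ(P_γ^{k₀}) ≤ τ` and `τ(P_γ) ≤ M` for all `γ`. -/
def UniformContraction {Y I : Type*} [MeasurableSpace Y] [MeasurableSpace I]
    (d : Y → Y → ℝ) (P : Kernel (Y × I) Y) : Prop :=
  ∃ (k₀ : ℕ) (τ M : ℝ), 1 ≤ k₀ ∧ 0 ≤ τ ∧ τ < 1 ∧ 0 < M ∧
    ∀ γ, contractionCoeff d (kernelAt P γ ^ k₀) ≤ ENNReal.ofReal τ ∧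
      contractionCoeff d (kernelAt P γ) ≤ ENNReal.ofReal M

/-! ### Adaptive chains and AIR schemes -/

/-- `ℱ_n = σ(Y_0, …, Y_n, Γ_0, …, Γ_n)`. -/
@[reducible] def history {Ω Y I : Type*} [MeasurableSpace Y] [MeasurableSpace I]
    (Yc : ℕ → Ω → Y) (Γ : ℕ → Ω → I) (n : ℕ) : MeasurableSpace Ω :=
  ⨆ i ∈ Finset.range (n + 1),
    (MeasurableSpace.comap (Yc i) inferInstance ⊔ MeasurableSpace.comap (Γ i) inferInstance)

/-- `(Y_n, Γ_n)` is an adaptive chain driven by the kernels `P_γ` and started in `(y₀, γ₀)`: given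
the history `ℱ_n`, the state `Y_{n+1}` has law `P_{Γ_n}(Y_n, ·)`, and the parameters follow
measurable update rules `Γ_n = U_n(Y_0, …, Y_n, Γ_0, …, Γ_{n-1})`. -/
structure IsAdaptiveChain {Ω Y I : Type*} [MeasurableSpace Ω] [MeasurableSpace Y]
    [MeasurableSpace I] (Pr : Measure Ω) (P : Kernel (Y × I) Y) (y₀ : Y) (γ₀ : I)
    (Yc : ℕ → Ω → Y) (Γ : ℕ → Ω → I) : Prop where
  measurable_state : ∀ n, Measurable (Yc n)
  measurable_param : ∀ n, Measurable (Γ n)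
  init_state : ∀ ω, Yc 0 ω = y₀
  init_param : ∀ ω, Γ 0 ω = γ₀
  transition : ∀ (n : ℕ) (B : Set Y), MeasurableSet B →
    Pr[(Yc (n + 1) ⁻¹' B).indicator (fun _ => (1 : ℝ)) | history Yc Γ n]
      =ᵐ[Pr] fun ω => (kernelAt P (Γ n ω) (Yc n ω)).real B
  update : ∃ U : (n : ℕ) → (Fin (n + 1) → Y) × (Fin n → I) → I,
    (∀ n, Measurable (U n)) ∧
      ∀ n ω, Γ n ω = U n (fun i => Yc i ω, fun i => Γ i ω)

/-- The adaptation times `T_m = ∑_{j=1}^m ⌈j^β⌉`, with `T_0 = 0`. -/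
def adaptationTime (β : ℝ) (m : ℕ) : ℕ :=
  ∑ j ∈ Finset.Icc 1 m, ⌈(j : ℝ) ^ β⌉₊

/-- The parameter is adapted only at the times `T_m`: it is constant on every block
`{T_j, …, T_{j+1} - 1}`. -/
def IsAIR {Ω I : Type*} (β : ℝ) (Γ : ℕ → Ω → I) : Prop :=
  ∀ j i₁ i₂ : ℕ, i₁ ∈ Set.Ico (adaptationTime β j) (adaptationTime β (j + 1)) →
    i₂ ∈ Set.Ico (adaptationTime β j) (adaptationTime β (j + 1)) → ∀ ω, Γ i₁ ω = Γ i₂ ω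

end AirMCMC

end

/-!
The proof represents the centred sums through solutions `g` of the Poisson equations
`g(·, γ) - P_γ g(·, γ) = f - ν f`, where `f` is read as a function on the product space.

* **Solving the equations** (`exists_poisson_solution`). Integrating a Lipschitz function against a
  coupling shows that a kernel with contraction coefficient `t` multiplies `ρ`-Lipschitz constants
  by at most `t` (`abs_integral_sub_le_of_contractionCoeff_le`), so the Lipschitz constants of
  `P_γ ^ k f` are summable in `k`, uniformly in `γ`. All `π_γ` have the same mean `ν f` of `f` and,
  by the drift condition, uniformly bounded moments `π_γ V`
  (`lintegral_invariant_le_of_drift`). As `ρ(x, y) ≤ 2 √V(x) √V(y)`, the series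
  `g = ∑ₖ (P_γ ^ k f - ν f)` converges and `|g| ≤ C √V`.
* **Decomposing the sums** (`IsAdaptiveChain.ae_tendsto_sum_div_rpow`). Write `G = P_γ g`. Then
  `f(X_{i+1}) - ν f` is the sum of the martingale difference `g(Y_{i+1}, Γ_i) - G(Y_i, Γ_i)`, of
  the jump `g(Y_{i+1}, Γ_{i+1}) - g(Y_{i+1}, Γ_i)`, and of the telescoping term
  `G(Y_i, Γ_i) - G(Y_{i+1}, Γ_{i+1})`.
* **Estimating the parts.** The moments `E V(Y_n)` are bounded, and only second moments of `√V` are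
  needed. Put `s = 1/2 + ε`. The martingale with increments weighted by `n ^ (-s)` is bounded in
  `L²`. The jumps vanish except at the adaptation times `T_m`, which grow like `m ^ (1 + β)`;
  weighted by `n ^ (-s)` they have a finite expected sum because `(1 + β) s > 1`. Kronecker's lemma
  (`kronecker_lemma`) turns both convergent series into the rate `n ^ s`. The remainder
  `G(Y_n, Γ_n)` is `o(n ^ s)`, since `∑ V(Y_n) / n ^ (2 s)` has finite expectation.
-/

namespace AirMCMC

/-! ### Kronecker's lemma -/

/-- Kronecker's lemma: if `∑ a i` converges and the weights `w` increase to infinity, then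
`∑_{i < n} w (i + 1) * a i = o(w n)`. -/
theorem kronecker_lemma {w a : ℕ → ℝ} (hw : Monotone w) (hw_top : Tendsto w atTop atTop)
    {S : ℝ} (hS : Tendsto (fun n => ∑ i ∈ Finset.range n, a i) atTop (𝓝 S)) :
    Tendsto (fun n => (∑ i ∈ Finset.range n, w (i + 1) * a i) / w n) atTop (𝓝 0) := by
  set T : ℕ → ℝ := fun n => ∑ i ∈ Finset.range n, a i - S with hT
  have hT0 : Tendsto T atTop (𝓝 0) := by simpa using hS.sub_const S
  -- summation by parts, with the tails `T` in place of the partial sums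
  have abel : ∀ n, ∑ i ∈ Finset.range n, w (i + 1) * a i
      = w n * T n - w 0 * T 0 - ∑ i ∈ Finset.range n, (w (i + 1) - w i) * T i := by
    intro n
    induction n with
    | zero => simp
    | succ n ih =>
      rw [Finset.sum_range_succ, ih, Finset.sum_range_succ]
      have : T (n + 1) = T n + a n := by simp only [hT, Finset.sum_range_succ]; ring
      rw [this]; ring
  have tele : ∀ n, ∑ i ∈ Finset.range n, (w (i + 1) - w i) = w n - w 0 :=
    fun n => Finset.sum_range_sub w n
  have hlo : (fun n => ∑ i ∈ Finset.range n, (w (i + 1) - w i) * T i)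
      =o[atTop] fun n => ∑ i ∈ Finset.range n, (w (i + 1) - w i) := by
    refine Asymptotics.IsLittleO.sum_range ?_ (fun i => sub_nonneg.2 (hw i.le_succ)) ?_
    · have h1 : T =o[atTop] (fun _ => (1 : ℝ)) := (Asymptotics.isLittleO_one_iff ℝ).2 hT0
      simpa using (Asymptotics.isBigO_refl (fun i => w (i + 1) - w i) atTop).mul_isLittleO h1
    · simp only [tele]
      exact tendsto_atTop_add_const_right _ _ hw_top
  have hbig : (fun n => ∑ i ∈ Finset.range n, (w (i + 1) - w i)) =O[atTop] w := by
    simp only [tele]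
    refine (Asymptotics.isBigO_refl w atTop).sub ?_
    exact (Asymptotics.isLittleO_const_left.2
      (Or.inr (tendsto_norm_atTop_atTop.comp hw_top))).isBigO
  have h3 := (hlo.trans_isBigO hbig).tendsto_div_nhds_zero
  have h2 : Tendsto (fun n => w 0 * T 0 / w n) atTop (𝓝 0) :=
    tendsto_const_nhds.div_atTop hw_top
  have h := (hT0.sub h2).sub h3
  simp only [sub_zero] at h
  refine h.congr' ?_
  filter_upwards [hw_top.eventually_gt_atTop 0] with n hn
  rw [abel]
  field_simp

/-! ### Almost sure convergence of random series -/

/-- A weighted series of nonnegative random variables with bounded expectations converges almost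
surely, as its expectation is finite. -/
theorem ae_summable_of_lintegral_le {Ω : Type*} [MeasurableSpace Ω] {μ : Measure Ω}
    {F : ℕ → Ω → ℝ} (hF : ∀ i, Measurable (F i)) (hF0 : ∀ i ω, 0 ≤ F i ω) {C : ℝ}
    (hC : ∀ i, ∫⁻ ω, ENNReal.ofReal (F i ω) ∂μ ≤ ENNReal.ofReal C)
    {w : ℕ → ℝ} (hw0 : ∀ i, 0 ≤ w i) (hw : Summable w) :
    ∀ᵐ ω ∂μ, Summable fun i => w i * F i ω := by
  have hfin : ∫⁻ ω, ∑' i, ENNReal.ofReal (w i * F i ω) ∂μ ≠ ∞ := by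
    rw [lintegral_tsum fun i => ((hF i).const_mul _).ennreal_ofReal.aemeasurable]
    refine ne_top_of_le_ne_top ?_ (ENNReal.tsum_le_tsum (g := fun i =>
      ENNReal.ofReal (w i) * ENNReal.ofReal C) fun i => ?_)
    · rw [ENNReal.tsum_mul_right]
      exact ENNReal.mul_ne_top hw.tsum_ofReal_ne_top ENNReal.ofReal_ne_top
    · simp only [ENNReal.ofReal_mul (hw0 i)]
      rw [lintegral_const_mul' _ _ ENNReal.ofReal_ne_top]
      gcongr
      exact hC i
  have hmeas : Measurable fun ω => ∑' i, ENNReal.ofReal (w i * F i ω) :=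
    Measurable.tsum fun i => ((hF i).const_mul _).ennreal_ofReal
  filter_upwards [ae_lt_top hmeas hfin] with ω hω
  have := ENNReal.summable_toReal hω.ne
  refine this.congr fun i => ?_
  rw [ENNReal.toReal_ofReal (mul_nonneg (hw0 i) (hF0 i ω))]

/-- A series of square integrable martingale differences whose variances are summable converges
almost surely. -/
theorem ae_exists_tendsto_sum_of_martingale_difference {Ω : Type*} {m0 : MeasurableSpace Ω}
    {μ : Measure Ω} [IsProbabilityMeasure μ] (ℱ : Filtration ℕ m0) {D : ℕ → Ω → ℝ}
    (hD : ∀ i, StronglyMeasurable[ℱ (i + 1)] (D i)) (hL2 : ∀ i, MemLp (D i) 2 μ)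
    (hcond : ∀ i, μ[D i | ℱ i] =ᵐ[μ] 0) (hsum : Summable fun i => ∫ ω, D i ω ^ 2 ∂μ) :
    ∀ᵐ ω ∂μ, ∃ S, Tendsto (fun n => ∑ i ∈ Finset.range n, D i ω) atTop (𝓝 S) := by
  set M : ℕ → Ω → ℝ := fun n ω => ∑ i ∈ Finset.range n, D i ω with hM
  have hMsucc : ∀ n, M (n + 1) = M n + D n := fun n => by
    ext ω; simp [hM, Finset.sum_range_succ]
  have hMmeas : ∀ n, StronglyMeasurable[ℱ n] (M n) := fun n =>
    Finset.stronglyMeasurable_fun_sum _ fun i hi =>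
      (hD i).mono (ℱ.mono (Finset.mem_range.1 hi))
  have hML2 : ∀ n, MemLp (M n) 2 μ := fun n => memLp_finsetSum _ fun i _ => hL2 i
  have hmart : Martingale M ℱ μ := by
    refine martingale_of_condExp_sub_eq_zero_nat hMmeas
      (fun n => (hML2 n).integrable one_le_two) fun n => ?_
    rw [hMsucc, add_sub_cancel_left]
    exact hcond n
  -- orthogonality of the increments
  have horth : ∀ n, ∫ ω, M n ω * D n ω ∂μ = 0 := fun n => by
    have hint : Integrable (M n * D n) μ := (hML2 n).integrable_mul (hL2 n)
    have h1 : μ[M n * D n | ℱ n] =ᵐ[μ] 0 := by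
      filter_upwards [condExp_mul_of_stronglyMeasurable_left (hMmeas n) hint
        ((hL2 n).integrable one_le_two), hcond n] with ω h h'
      rw [h, Pi.mul_apply, h']; simp
    calc ∫ ω, M n ω * D n ω ∂μ = ∫ ω, (μ[M n * D n | ℱ n]) ω ∂μ :=
          (integral_condExp (ℱ.le n)).symm
      _ = 0 := by rw [integral_congr_ae h1]; simp
  have hsq : ∀ n, ∫ ω, M n ω ^ 2 ∂μ = ∑ i ∈ Finset.range n, ∫ ω, D i ω ^ 2 ∂μ := fun n => by
    induction n with
    | zero => simp [hM]
    | succ n ih =>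
      have e : ∀ ω, M (n + 1) ω ^ 2 = M n ω ^ 2 + D n ω ^ 2 + 2 * (M n ω * D n ω) := fun ω => by
        rw [hMsucc, Pi.add_apply]; ring
      have i1 := (hML2 n).integrable_sq
      have i2 := (hL2 n).integrable_sq
      have i3 : Integrable (fun ω => M n ω * D n ω) μ := (hML2 n).integrable_mul (hL2 n)
      calc ∫ ω, M (n + 1) ω ^ 2 ∂μ
          = ∫ ω, (M n ω ^ 2 + D n ω ^ 2 + 2 * (M n ω * D n ω)) ∂μ := by simp only [e]
        _ = ∫ ω, (M n ω ^ 2 + D n ω ^ 2) ∂μ + ∫ ω, 2 * (M n ω * D n ω) ∂μ :=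
          integral_add (i1.add i2) (i3.const_mul 2)
        _ = _ := by
          rw [integral_add i1 i2, integral_const_mul, horth, ih, Finset.sum_range_succ]
          ring
  set R : ℝ := 1 + ∑' i, ∫ ω, D i ω ^ 2 ∂μ
  have hbdd : ∀ n, eLpNorm (M n) 1 μ ≤ (R.toNNReal : ℝ≥0∞) := fun n => by
    have hi := (hML2 n).integrable one_le_two
    rw [eLpNorm_one_eq_lintegral_enorm, ← ofReal_integral_norm_eq_lintegral_enorm hi]
    refine ENNReal.ofReal_le_ofReal ?_
    calc ∫ ω, ‖M n ω‖ ∂μ ≤ ∫ ω, (1 + M n ω ^ 2) ∂μ := by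
          refine integral_mono hi.norm ((integrable_const 1).add (hML2 n).integrable_sq) fun ω => ?_
          have := sq_abs (M n ω)
          simp only [Real.norm_eq_abs]
          nlinarith [sq_nonneg (|M n ω| - 1), abs_nonneg (M n ω)]
      _ = 1 + ∑ i ∈ Finset.range n, ∫ ω, D i ω ^ 2 ∂μ := by
          rw [integral_add (integrable_const 1) (hML2 n).integrable_sq, hsq]; simp
      _ ≤ R := by
          have := hsum.sum_le_tsum (Finset.range n) fun i _ =>
            integral_nonneg fun ω => sq_nonneg (D i ω)
          simp only [R]
          linarith
  exact hmart.submartingale.exists_ae_tendsto_of_bdd hbdd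

/-! ### Adaptation times -/

theorem adaptationTime_zero (β : ℝ) : adaptationTime β 0 = 0 := by simp [adaptationTime]

theorem adaptationTime_succ (β : ℝ) (m : ℕ) :
    adaptationTime β (m + 1) = adaptationTime β m + ⌈((m + 1 : ℕ) : ℝ) ^ β⌉₊ := by
  rw [adaptationTime, Finset.sum_Icc_succ_top (by omega)]; rfl

theorem adaptationTime_strictMono (β : ℝ) : StrictMono (adaptationTime β) := by
  refine strictMono_nat_of_lt_succ fun m => ?_
  rw [adaptationTime_succ]
  have : 0 < ⌈((m + 1 : ℕ) : ℝ) ^ β⌉₊ := Nat.ceil_pos.2 (by positivity)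
  omega

/-- `T_m` grows at least like `m ^ (1 + β)`. -/
theorem rpow_le_adaptationTime {β : ℝ} (hβ : 0 < β) (m : ℕ) :
    (m : ℝ) ^ (1 + β) ≤ (1 + β) * adaptationTime β m := by
  induction m with
  | zero => simp [Real.zero_rpow (by positivity : 1 + β ≠ 0), adaptationTime_zero]
  | succ m ih =>
    set x : ℝ := ((m + 1 : ℕ) : ℝ) with hx
    have hx0 : 0 < x := by positivity
    have hx1 : (m : ℝ) = x * (1 + -(1 / x)) := by
      rw [hx]; push_cast; field_simp; ring
    have hle : 1 / x ≤ 1 := by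
      rw [div_le_one hx0, hx]; push_cast; linarith [Nat.cast_nonneg (α := ℝ) m]
    have hb := one_add_mul_self_le_rpow_one_add (s := -(1 / x)) (by linarith)
      (by linarith : 1 ≤ 1 + β)
    -- Bernoulli's inequality for `(1 - 1 / x) ^ (1 + β)`, with `x = m + 1`
    have hm : x ^ (1 + β) - (1 + β) * x ^ β ≤ (m : ℝ) ^ (1 + β) := by
      rw [hx1, Real.mul_rpow hx0.le (by linarith)]
      refine le_trans (le_of_eq ?_) (mul_le_mul_of_nonneg_left hb (by positivity))
      rw [Real.rpow_add hx0, Real.rpow_one]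
      field_simp
      ring
    have hc := Nat.le_ceil (x ^ β)
    rw [adaptationTime_succ, ← hx]
    push_cast
    nlinarith

/-- The weights `n ^ (-s)` are summable along the adaptation times as soon as `(1 + β) s > 1`. -/
theorem summable_indicator_adaptationTime {β s : ℝ} (hβ : 0 < β) (hs : 0 < s)
    (hβs : 1 < (1 + β) * s) :
    Summable fun i : ℕ => (Set.range (adaptationTime β)).indicator
      (fun k : ℕ => 1 / (k : ℝ) ^ s) (i + 1) := by
  refine (summable_nat_add_iff (f := (Set.range (adaptationTime β)).indicator
      (fun k : ℕ => 1 / (k : ℝ) ^ s)) 1).2 ?_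
  rw [← (adaptationTime_strictMono β).injective.summable_iff
    (fun x hx => Set.indicator_of_notMem hx _)]
  have hsum : Summable fun m : ℕ => (1 + β) ^ s * (1 / (m : ℝ) ^ ((1 + β) * s)) :=
    (Real.summable_one_div_nat_rpow.2 hβs).mul_left _
  have hcomp : ∀ m, ((Set.range (adaptationTime β)).indicator (fun k : ℕ => 1 / (k : ℝ) ^ s) ∘
      adaptationTime β) m = 1 / (adaptationTime β m : ℝ) ^ s := fun m => by
    rw [Function.comp_apply, Set.indicator_of_mem (Set.mem_range_self m)]
  refine hsum.of_nonneg_of_le (fun m => ?_) fun m => ?_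
  · rw [hcomp]; positivity
  rw [hcomp]
  rcases Nat.eq_zero_or_pos m with rfl | hm
  -- the convention `1 / 0 = 0` makes the term at `T_0 = 0` vanish
  · rw [adaptationTime_zero]
    simp only [Nat.cast_zero, Real.zero_rpow hs.ne', div_zero]
    positivity
  · have hm' : (0 : ℝ) < m := by exact_mod_cast hm
    have hT : (0 : ℝ) < adaptationTime β m := by
      exact_mod_cast (adaptationTime_zero β ▸ adaptationTime_strictMono β hm :)
    rw [mul_one_div, div_le_div_iff₀ (by positivity) (by positivity), one_mul,
      ← Real.mul_rpow (by positivity) hT.le, Real.rpow_mul hm'.le]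
    gcongr
    exact rpow_le_adaptationTime hβ m

/-- Under an AIR scheme the parameter can only change at an adaptation time. -/
theorem IsAIR.param_succ_eq {Ω I : Type*} {β : ℝ} {Γ : ℕ → Ω → I} (h : IsAIR β Γ) {i : ℕ}
    (hi : i + 1 ∉ Set.range (adaptationTime β)) (ω : Ω) : Γ (i + 1) ω = Γ i ω := by
  -- `Nat.find hex` is the index of the block that contains `i`.
  have hex : ∃ m, i < adaptationTime β (m + 1) :=
    ⟨i, lt_of_lt_of_le i.lt_succ_self ((adaptationTime_strictMono β).le_apply)⟩
  have h1 := Nat.find_spec hex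
  have h2 : adaptationTime β (Nat.find hex) ≤ i := by
    rcases hk : Nat.find hex with _ | k
    · simp [adaptationTime_zero]
    · exact not_lt.1 (Nat.find_min hex (m := k) (by omega))
  have h3 : i + 1 ≠ adaptationTime β (Nat.find hex + 1) := fun h => hi ⟨_, h.symm⟩
  exact h (Nat.find hex) _ _ ⟨by omega, by omega⟩ ⟨h2, h1⟩ ω

/-! ### Drift estimates for a single kernel -/

section Kernel

variable {S : Type*} [MeasurableSpace S] {K : Kernel S S} {V : S → ℝ} {κ b : ℝ}

theorem isMarkovKernel_pow [IsMarkovKernel K] (k : ℕ) : IsMarkovKernel (K ^ k) := by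
  induction k with
  | zero => exact inferInstanceAs (IsMarkovKernel Kernel.id)
  | succ k ih => rw [pow_succ]; exact inferInstanceAs (IsMarkovKernel ((K ^ k) ∘ₖ K))

theorem invariant_pow {μ : Measure S} (hK : K.Invariant μ) (k : ℕ) : (K ^ k).Invariant μ := by
  induction k with
  | zero => exact Measure.bind_dirac
  | succ k ih => rw [pow_succ]; exact Kernel.Invariant.comp ih hK

/-- Iterating the drift condition `K V ≤ κ V + b`. -/
theorem lintegral_pow_le_of_drift [IsMarkovKernel K] (hVm : Measurable V) (hV : ∀ y, 1 ≤ V y)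
    (hκ0 : 0 < κ) (hκ1 : κ < 1) (hb : 0 < b)
    (hdrift : ∀ y, ∫⁻ y', ENNReal.ofReal (V y') ∂(K y) ≤ ENNReal.ofReal (κ * V y + b))
    (k : ℕ) (y : S) :
    ∫⁻ y', ENNReal.ofReal (V y') ∂((K ^ k) y)
      ≤ ENNReal.ofReal (κ ^ k * V y + b / (1 - κ)) := by
  have h1κ : 0 < 1 - κ := by linarith
  induction k with
  | zero =>
    change ∫⁻ y', ENNReal.ofReal (V y') ∂(Kernel.id y) ≤ _
    rw [Kernel.id_apply, lintegral_dirac' _ hVm.ennreal_ofReal]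
    exact ENNReal.ofReal_le_ofReal (by have := div_pos hb h1κ; simp; linarith)
  | succ k ih =>
    have := isMarkovKernel_pow (K := K) k
    rw [add_comm, Kernel.pow_add, pow_one, Kernel.lintegral_comp _ _ _ hVm.ennreal_ofReal]
    calc ∫⁻ x, ∫⁻ y', ENNReal.ofReal (V y') ∂(K x) ∂((K ^ k) y)
        ≤ ∫⁻ x, (ENNReal.ofReal κ * ENNReal.ofReal (V x) + ENNReal.ofReal b) ∂((K ^ k) y) := by
          refine lintegral_mono fun x => (hdrift x).trans (le_of_eq ?_)
          rw [ENNReal.ofReal_add (by nlinarith [hV x]) hb.le, ENNReal.ofReal_mul hκ0.le]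
      _ = ENNReal.ofReal κ * ∫⁻ x, ENNReal.ofReal (V x) ∂((K ^ k) y) + ENNReal.ofReal b := by
          rw [lintegral_add_right _ measurable_const, lintegral_const_mul _ hVm.ennreal_ofReal]
          simp
      _ ≤ ENNReal.ofReal κ * ENNReal.ofReal (κ ^ k * V y + b / (1 - κ)) + ENNReal.ofReal b := by
          gcongr
      _ = ENNReal.ofReal (κ ^ (1 + k) * V y + b / (1 - κ)) := by
          have hnn : 0 ≤ κ ^ k * V y + b / (1 - κ) := by
            have := hV y
            positivity
          rw [← ENNReal.ofReal_mul hκ0.le, ← ENNReal.ofReal_add (by positivity) hb.le]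
          congr 1
          field_simp
          ring

/-- The drift condition bounds the moment of `V` under an invariant probability measure. The
truncations `min V N` are averaged with the powers of the kernel, since finiteness of the moment
is not known beforehand. -/
theorem lintegral_invariant_le_of_drift [IsMarkovKernel K] {μ : Measure S} [IsProbabilityMeasure μ]
    (hK : K.Invariant μ) (hVm : Measurable V) (hV : ∀ y, 1 ≤ V y)
    (hκ0 : 0 < κ) (hκ1 : κ < 1) (hb : 0 < b)
    (hdrift : ∀ y, ∫⁻ y', ENNReal.ofReal (V y') ∂(K y) ≤ ENNReal.ofReal (κ * V y + b)) :
    ∫⁻ y, ENNReal.ofReal (V y) ∂μ ≤ ENNReal.ofReal (b / (1 - κ)) := by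
  have htrunc : ∀ N : ℕ, ∫⁻ y, min (ENNReal.ofReal (V y)) N ∂μ ≤ ENNReal.ofReal (b / (1 - κ)) := by
    intro N
    have hm : Measurable fun y => min (ENNReal.ofReal (V y)) (N : ℝ≥0∞) :=
      hVm.ennreal_ofReal.min measurable_const
    have hk : ∀ k : ℕ, ∫⁻ y, min (ENNReal.ofReal (V y)) N ∂μ
        ≤ ∫⁻ y, min (ENNReal.ofReal (κ ^ k * V y + b / (1 - κ))) N ∂μ := by
      intro k
      have := isMarkovKernel_pow (K := K) k
      conv_lhs => rw [← (invariant_pow hK k).def]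
      rw [Measure.lintegral_bind (Kernel.aemeasurable _) hm.aemeasurable]
      refine lintegral_mono fun y => le_min ?_ ?_
      · exact (lintegral_mono fun x => min_le_left _ _).trans
          (lintegral_pow_le_of_drift hVm hV hκ0 hκ1 hb hdrift k y)
      · refine (lintegral_mono fun x => min_le_right _ _).trans ?_
        simp
    -- the bound for the `k`-th power loses its dependence on `y` as `k → ∞`
    have hlim : Tendsto (fun k : ℕ => ∫⁻ y, min (ENNReal.ofReal (κ ^ k * V y + b / (1 - κ))) N ∂μ)
        atTop (𝓝 (∫⁻ _, min (ENNReal.ofReal (b / (1 - κ))) N ∂μ)) := by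
      refine tendsto_lintegral_of_dominated_convergence (fun _ => (N : ℝ≥0∞)) (fun k => ?_)
        (fun k => ae_of_all _ fun y => min_le_right _ _) (by simp) (ae_of_all _ fun y => ?_)
      · exact ((hVm.const_mul _).add_const _).ennreal_ofReal.min measurable_const
      · refine Tendsto.min (ENNReal.tendsto_ofReal ?_) tendsto_const_nhds
        simpa using ((tendsto_pow_atTop_nhds_zero_of_lt_one hκ0.le hκ1).mul_const
          (V y)).add_const (b / (1 - κ))
    refine (ge_of_tendsto' hlim hk).trans ?_
    simp
  -- removing the truncation by monotone convergence
  have hmono : Tendsto (fun N : ℕ => ∫⁻ y, min (ENNReal.ofReal (V y)) N ∂μ) atTop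
      (𝓝 (∫⁻ y, ENNReal.ofReal (V y) ∂μ)) := by
    refine lintegral_tendsto_of_tendsto_of_monotone
      (fun N => (hVm.ennreal_ofReal.min measurable_const).aemeasurable)
      (ae_of_all _ fun y => fun N N' h => by
        dsimp only
        gcongr) (ae_of_all _ fun y => ?_)
    refine tendsto_const_nhds.congr' ?_
    filter_upwards [eventually_ge_atTop ⌈V y⌉₊] with N hN
    rw [min_eq_left]
    rw [← ENNReal.ofReal_natCast]
    exact ENNReal.ofReal_le_ofReal ((Nat.le_ceil _).trans (by exact_mod_cast hN))
  exact le_of_tendsto' hmono htrunc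

theorem integrable_of_lintegral_ofReal_le {μ : Measure S} (hVm : Measurable V) (hV : ∀ y, 1 ≤ V y)
    {C : ℝ} (h : ∫⁻ y, ENNReal.ofReal (V y) ∂μ ≤ ENNReal.ofReal C) : Integrable V μ :=
  (lintegral_ofReal_ne_top_iff_integrable hVm.aestronglyMeasurable
    (ae_of_all _ fun y => zero_le_one.trans (hV y))).1
    (ne_top_of_le_ne_top ENNReal.ofReal_ne_top h)

theorem integral_le_of_lintegral_ofReal_le {μ : Measure S} (hVm : Measurable V)
    (hV : ∀ y, 1 ≤ V y) {C : ℝ} (hC : 0 ≤ C)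
    (h : ∫⁻ y, ENNReal.ofReal (V y) ∂μ ≤ ENNReal.ofReal C) : ∫ y, V y ∂μ ≤ C := by
  rw [integral_eq_lintegral_of_nonneg_ae (ae_of_all _ fun y => zero_le_one.trans (hV y))
    hVm.aestronglyMeasurable]
  exact ENNReal.toReal_le_of_le_ofReal hC h

theorem sqrt_le_self_of_one_le {x : ℝ} (hx : 1 ≤ x) : √x ≤ x :=
  Real.sqrt_le_iff.2 ⟨by linarith, by nlinarith⟩

theorem integrable_of_abs_le_sqrt {μ : Measure S} {h : S → ℝ} (hh : Measurable h)
    (hV : ∀ y, 1 ≤ V y) (hVi : Integrable V μ) {C : ℝ} (hC : 0 ≤ C)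
    (hle : ∀ y, |h y| ≤ C * √(V y)) : Integrable h μ :=
  (hVi.const_mul C).mono' hh.aestronglyMeasurable (ae_of_all _ fun y => by
    rw [Real.norm_eq_abs]
    exact (hle y).trans (mul_le_mul_of_nonneg_left (sqrt_le_self_of_one_le (hV y)) hC))

/-! ### Contraction of Lipschitz functions -/

variable {ρ : S → S → ℝ}

/-- The easy half of Kantorovich duality: a kernel with contraction coefficient at most `t` maps
`ρ`-Lipschitz functions with constant `l` to `ρ`-Lipschitz functions with constant `l * t`. -/
theorem abs_integral_sub_le_of_contractionCoeff_le {Q : Kernel S S}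
    (hρ0 : ∀ x y, 0 ≤ ρ x y) (hρ : ∀ x y, x ≠ y → 0 < ρ x y) {t : ℝ} (ht : 0 ≤ t)
    (hQ : contractionCoeff ρ Q ≤ ENNReal.ofReal t) {g : S → ℝ} (hg : ∀ y, Integrable g (Q y))
    {l : ℝ} (hl : 0 ≤ l) (hlip : ∀ x y, |g x - g y| ≤ l * ρ x y) (x y : S) :
    |∫ z, g z ∂(Q x) - ∫ z, g z ∂(Q y)| ≤ l * t * ρ x y := by
  rcases eq_or_ne x y with rfl | hxy
  · simpa using mul_nonneg (mul_nonneg hl ht) (hρ0 x x)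
  have hW : wassersteinLike ρ (Q x) (Q y) ≤ ENNReal.ofReal (t * ρ x y) := by
    have h1 : wassersteinLike ρ (Q x) (Q y) / ENNReal.ofReal (ρ x y) ≤ ENNReal.ofReal t :=
      by
      refine le_trans ?_ hQ
      exact le_iSup₂_of_le x y (le_iSup_of_le hxy le_rfl)
    rw [ENNReal.div_le_iff (by simpa using hρ x y hxy) ENNReal.ofReal_ne_top] at h1
    rwa [ENNReal.ofReal_mul ht]
  have hcoup : ∀ ξ : Measure (S × S), IsCoupling ξ (Q x) (Q y) →
      ENNReal.ofReal |∫ z, g z ∂(Q x) - ∫ z, g z ∂(Q y)|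
        ≤ ENNReal.ofReal l * ∫⁻ z, ENNReal.ofReal (ρ z.1 z.2) ∂ξ := by
    intro ξ hξ
    have i1 : Integrable (fun z : S × S => g z.1) ξ := by
      have := hg x
      rw [← hξ.1] at this
      exact this.comp_measurable measurable_fst
    have i2 : Integrable (fun z : S × S => g z.2) ξ := by
      have := hg y
      rw [← hξ.2] at this
      exact this.comp_measurable measurable_snd
    have e1 : ∫ z, g z ∂(Q x) = ∫ z, g z.1 ∂ξ := by
      have := (hg x).aestronglyMeasurable
      rw [← hξ.1] at this ⊢
      exact integral_map measurable_fst.aemeasurable this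
    have e2 : ∫ z, g z ∂(Q y) = ∫ z, g z.2 ∂ξ := by
      have := (hg y).aestronglyMeasurable
      rw [← hξ.2] at this ⊢
      exact integral_map measurable_snd.aemeasurable this
    rw [e1, e2, ← integral_sub i1 i2]
    calc ENNReal.ofReal |∫ z, (g z.1 - g z.2) ∂ξ|
        ≤ ENNReal.ofReal (∫ z, ‖g z.1 - g z.2‖ ∂ξ) :=
          ENNReal.ofReal_le_ofReal
            (norm_integral_le_integral_norm fun z : S × S => g z.1 - g z.2)
      _ = ∫⁻ z, ENNReal.ofReal ‖g z.1 - g z.2‖ ∂ξ :=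
          ofReal_integral_eq_lintegral_ofReal (i1.sub i2).norm (ae_of_all _ fun z => norm_nonneg _)
      _ ≤ ∫⁻ z, ENNReal.ofReal l * ENNReal.ofReal (ρ z.1 z.2) ∂ξ := by
          refine lintegral_mono fun z => ?_
          rw [← ENNReal.ofReal_mul hl]
          exact ENNReal.ofReal_le_ofReal (hlip z.1 z.2)
      _ = _ := lintegral_const_mul' _ _ ENNReal.ofReal_ne_top
  -- The infimum over couplings need not be attained, so a coupling is chosen up to an error whose
  -- contribution, after multiplication by `l`, is at most `δ`.
  refine le_of_forall_pos_le_add fun δ hδ => ?_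
  have hδl : 0 < δ / (l + 1) := by positivity
  have hW' : wassersteinLike ρ (Q x) (Q y) < ENNReal.ofReal (t * ρ x y + δ / (l + 1)) :=
    hW.trans_lt ((ENNReal.ofReal_lt_ofReal_iff_of_nonneg (mul_nonneg ht (hρ0 x y))).2 (by linarith))
  obtain ⟨ξ, hξ, hξlt⟩ : ∃ ξ : Measure (S × S), ∃ _ : IsCoupling ξ (Q x) (Q y),
      ∫⁻ z, ENNReal.ofReal (ρ z.1 z.2) ∂ξ < ENNReal.ofReal (t * ρ x y + δ / (l + 1)) := by
    simpa only [wassersteinLike, iInf_lt_iff] using hW'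
  have h1 := (hcoup ξ hξ).trans (mul_le_mul_right hξlt.le _)
  rw [← ENNReal.ofReal_mul hl, ENNReal.ofReal_le_ofReal_iff
    (mul_nonneg hl (add_nonneg (mul_nonneg ht (hρ0 x y)) hδl.le))] at h1
  refine h1.trans ?_
  have h2 : l * (δ / (l + 1)) ≤ δ := by
    rw [mul_div_assoc', div_le_iff₀ (by positivity)]
    nlinarith
  linarith

/-- The Lipschitz constant of `K ^ k h`, for a kernel `K` with contraction coefficient at most `M`
whose power `K ^ k₀` has contraction coefficient at most `τ`. -/
theorem abs_integral_pow_sub_le {k₀ : ℕ} {τ M l : ℝ}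
    (hρ0 : ∀ x y, 0 ≤ ρ x y) (hρ : ∀ x y, x ≠ y → 0 < ρ x y)
    (hτ : 0 ≤ τ) (hM : 0 ≤ M) (hl : 0 ≤ l)
    (hKτ : contractionCoeff ρ (K ^ k₀) ≤ ENNReal.ofReal τ)
    (hKM : contractionCoeff ρ K ≤ ENNReal.ofReal M)
    {h : S → ℝ} (hh : Measurable h) (hint : ∀ k y, Integrable h ((K ^ k) y))
    (hlip : ∀ x y, |h x - h y| ≤ l * ρ x y) (k : ℕ) (x y : S) :
    |∫ z, h z ∂((K ^ k) x) - ∫ z, h z ∂((K ^ k) y)|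
      ≤ l * (τ ^ (k / k₀) * M ^ (k % k₀)) * ρ x y := by
  have hadd : ∀ m n x, ∫ z, h z ∂((K ^ (m + n)) x) = ∫ w, ∫ z, h z ∂((K ^ m) w) ∂((K ^ n) x) :=
    fun m n x => by
      have := hint (m + n) x
      rw [Kernel.pow_add] at this ⊢
      exact Kernel.integral_comp this
  have hiadd : ∀ m n x, Integrable (fun w => ∫ z, h z ∂((K ^ m) w)) ((K ^ n) x) :=
    fun m n x => by
      have := hint (m + n) x
      rw [Kernel.pow_add] at this
      exact this.integral_comp
  -- `q` steps of length `k₀`, each gaining a factor `τ`, and `r` single steps, each costing `M`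
  have hstep : ∀ q r : ℕ, ∀ x y,
      |∫ z, h z ∂((K ^ (k₀ * q + r)) x) - ∫ z, h z ∂((K ^ (k₀ * q + r)) y)|
      ≤ l * (τ ^ q * M ^ r) * ρ x y := by
    intro q r
    induction r with
    | succ r ih =>
      intro x y
      have := abs_integral_sub_le_of_contractionCoeff_le hρ0 hρ hM hKM
        (g := fun w => ∫ z, h z ∂((K ^ (k₀ * q + r)) w))
        (fun y => by simpa using hiadd (k₀ * q + r) 1 y) (by positivity) ih x y
      have e : ∀ x, ∫ z, h z ∂((K ^ (k₀ * q + (r + 1))) x)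
          = ∫ w, ∫ z, h z ∂((K ^ (k₀ * q + r)) w) ∂(K x) := fun x => by
        rw [← add_assoc, hadd, pow_one]
      rw [e, e]
      refine this.trans (le_of_eq ?_)
      ring
    | zero =>
      induction q with
      | zero =>
        intro x y
        have e : ∀ x, ∫ z, h z ∂((K ^ (k₀ * 0 + 0)) x) = h x := fun x => by
          change ∫ z, h z ∂(Kernel.id x) = h x
          rw [Kernel.id_apply, integral_dirac' _ _ hh.stronglyMeasurable]
        rw [e, e]
        simpa using hlip x y
      | succ q ih =>
        intro x y
        have := abs_integral_sub_le_of_contractionCoeff_le hρ0 hρ hτ hKτ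
          (g := fun w => ∫ z, h z ∂((K ^ (k₀ * q + 0)) w))
          (fun y => hiadd (k₀ * q + 0) k₀ y) (by positivity) ih x y
        have e : ∀ x, ∫ z, h z ∂((K ^ (k₀ * (q + 1) + 0)) x)
            = ∫ w, ∫ z, h z ∂((K ^ (k₀ * q + 0)) w) ∂((K ^ k₀) x) := fun x => by
          rw [← hadd]; congr 3
        rw [e, e]
        refine this.trans (le_of_eq ?_)
        ring
  have := hstep (k / k₀) (k % k₀) x y
  rwa [Nat.div_add_mod] at this

theorem summable_pow_div_mul_pow_mod {k₀ : ℕ} (hk₀ : 1 ≤ k₀) {τ M : ℝ} (hτ0 : 0 ≤ τ) (hτ1 : τ < 1)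
    (hM : 0 ≤ M) : Summable fun k : ℕ => τ ^ (k / k₀) * M ^ (k % k₀) := by
  have : NeZero k₀ := ⟨by omega⟩
  have h := (summable_geometric_of_lt_one hτ0 hτ1).mul_of_nonneg
    (Summable.of_finite (f := fun r : Fin k₀ => M ^ (r : ℕ))) (fun n => pow_nonneg hτ0 n)
    (fun r => pow_nonneg hM _)
  refine ((Nat.divModEquiv k₀).summable_iff.2 h).congr fun k => ?_
  simp [Nat.divModEquiv]

/-- Convergence of `K ^ k h` to the mean of `h` under an invariant probability measure, with the
rate of the Lipschitz constants and with growth at most `√V`. -/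
theorem abs_integral_pow_sub_integral_le {k : ℕ} [IsMarkovKernel K] {μ : Measure S}
    [IsProbabilityMeasure μ] (hK : K.Invariant μ)
    {h : S → ℝ} (hμ : Integrable h μ) (hVi : Integrable (fun y => √(V y)) μ)
    (hρV : ∀ x y, ρ x y ≤ 2 * √(V x) * √(V y)) {l : ℝ} (hl : 0 ≤ l)
    (hlip : ∀ x y, |∫ z, h z ∂((K ^ k) x) - ∫ z, h z ∂((K ^ k) y)| ≤ l * ρ x y) (y : S) :
    |∫ z, h z ∂((K ^ k) y) - ∫ z, h z ∂μ| ≤ 2 * l * (∫ x, √(V x) ∂μ) * √(V y) := by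
  have hμk : ((K ^ k) ∘ₖ Kernel.const S μ) y = μ := by
    rw [Kernel.Invariant.comp_const (invariant_pow hK k), Kernel.const_apply]
  have hi : Integrable (fun x => ∫ z, h z ∂((K ^ k) x)) μ := by
    have h' := hμ
    rw [← hμk] at h'
    simpa using h'.integral_comp
  have e : ∫ z, h z ∂μ = ∫ x, ∫ z, h z ∂((K ^ k) x) ∂μ := by
    have h' := hμ
    rw [← hμk] at h'
    have := Kernel.integral_comp h'
    rwa [hμk, Kernel.const_apply] at this
  -- by invariance, the mean of `h` is the `μ`-average of `K ^ k h`
  have e2 : ∫ z, h z ∂((K ^ k) y) - ∫ z, h z ∂μ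
      = ∫ x, (∫ z, h z ∂((K ^ k) y) - ∫ z, h z ∂((K ^ k) x)) ∂μ := by
    rw [integral_sub (integrable_const _) hi, ← e]; simp
  rw [e2]
  calc |∫ x, (∫ z, h z ∂((K ^ k) y) - ∫ z, h z ∂((K ^ k) x)) ∂μ|
      ≤ ∫ x, 2 * l * √(V y) * √(V x) ∂μ := by
        rw [← Real.norm_eq_abs]
        refine norm_integral_le_of_norm_le (hVi.const_mul _) (ae_of_all _ fun x => ?_)
        rw [Real.norm_eq_abs]
        refine (hlip y x).trans ?_
        calc l * ρ y x ≤ l * (2 * √(V y) * √(V x)) := by gcongr; exact hρV y x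
          _ = _ := by ring
    _ = _ := by rw [integral_const_mul]; ring

end Kernel

/-! ### The Poisson equation -/

/-- A solution `g` of the Poisson equations `g(·, γ) - P_γ g(·, γ) = h - c`, jointly measurable in
the state and the parameter, and of growth at most `√V` uniformly in the parameter: it is
`∑ₖ (P_γ ^ k h - c)`. -/
theorem exists_poisson_solution {S I : Type*} [MeasurableSpace S] [MeasurableSpace I]
    {P : Kernel (S × I) S} [IsMarkovKernel P] {π : I → Measure S}
    (hπ_prob : ∀ γ, IsProbabilityMeasure (π γ)) (hπ_inv : ∀ γ, (kernelAt P γ).Invariant (π γ))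
    {V : S → ℝ} (hVm : Measurable V) (hV : IsCommonLyapunov P V)
    {ρ : S → S → ℝ} (hρ0 : ∀ x y, 0 ≤ ρ x y) (hρ : ∀ x y, x ≠ y → 0 < ρ x y)
    (hρV : ∀ x y, ρ x y ≤ 2 * √(V x) * √(V y)) (hcontr : UniformContraction ρ P)
    {h : S → ℝ} (hh : Measurable h) (hle : ∀ y, |h y| ≤ √(V y)) (hlip : IsLipschitzWrt ρ h)
    {c : ℝ} (hc : ∀ γ, ∫ y, h y ∂(π γ) = c) :
    ∃ (g : S × I → ℝ) (C : ℝ), 0 ≤ C ∧ Measurable g ∧ (∀ z, |g z| ≤ C * √(V z.1)) ∧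
      ∀ z, ∫ y', g (y', z.2) ∂(P z) = g z - (h z.1 - c) := by
  obtain ⟨hV1, κ, b, hκ0, hκ1, hb, hdrift⟩ := hV
  obtain ⟨k₀, τ, M, hk₀, hτ0, hτ1, hM, hcon⟩ := hcontr
  obtain ⟨l, hl, hlip⟩ := hlip
  have hmarkov : ∀ γ, IsMarkovKernel (kernelAt P γ) := fun γ => by
    unfold kernelAt; infer_instance
  set B := b / (1 - κ) with hB
  have hB0 : 0 < B := div_pos hb (by linarith)
  have hVk : ∀ γ k y, Integrable V ((kernelAt P γ ^ k) y) := fun γ k y =>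
    integrable_of_lintegral_ofReal_le hVm hV1
      (lintegral_pow_le_of_drift hVm hV1 hκ0 hκ1 hb (hdrift γ) k y)
  have hVπ' := fun γ => lintegral_invariant_le_of_drift (hπ_inv γ) hVm hV1 hκ0 hκ1 hb (hdrift γ)
  have hVπ : ∀ γ, Integrable V (π γ) := fun γ => integrable_of_lintegral_ofReal_le hVm hV1 (hVπ' γ)
  have hsqrt : ∀ {μ : Measure S}, Integrable V μ → Integrable (fun y => √(V y)) μ := fun hi =>
    integrable_of_abs_le_sqrt hVm.sqrt hV1 hi zero_le_one
      fun y => by rw [abs_of_nonneg (Real.sqrt_nonneg _), one_mul]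
  have hint : ∀ γ k y, Integrable h ((kernelAt P γ ^ k) y) := fun γ k y =>
    integrable_of_abs_le_sqrt hh hV1 (hVk γ k y) zero_le_one fun y => by rw [one_mul]; exact hle y
  have hintπ : ∀ γ, Integrable h (π γ) := fun γ =>
    integrable_of_abs_le_sqrt hh hV1 (hVπ γ) zero_le_one fun y => by rw [one_mul]; exact hle y
  set a : ℕ → ℝ := fun k => τ ^ (k / k₀) * M ^ (k % k₀) with ha
  have ha0 : ∀ k, 0 ≤ a k := fun k => by positivity
  have hasum : Summable a := summable_pow_div_mul_pow_mod hk₀ hτ0 hτ1 hM.le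
  set u : ℕ → S × I → ℝ := fun k z => ∫ x, h x ∂((kernelAt P z.2 ^ k) z.1) with hu
  have hu0 : ∀ z, u 0 z = h z.1 := fun z => by
    change ∫ x, h x ∂(Kernel.id z.1) = h z.1
    rw [Kernel.id_apply, integral_dirac' _ _ hh.stronglyMeasurable]
  have husucc : ∀ k z, u (k + 1) z = ∫ y', u k (y', z.2) ∂(P z) := fun k z => by
    have := hint z.2 (k + 1) z.1
    simp only [hu]
    rw [pow_succ] at this ⊢
    exact Kernel.integral_comp this
  have humeas : ∀ k, Measurable (u k) := fun k => by
    induction k with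
    | zero => simp only [funext hu0]; exact hh.comp measurable_fst
    | succ k ih =>
      simp only [funext (husucc k)]
      have : Measurable fun w : (S × I) × S => u k (w.2, w.1.2) :=
        ih.comp (measurable_snd.prodMk (measurable_snd.comp measurable_fst))
      exact this.stronglyMeasurable.integral_kernel_prod_right'.measurable
  have hubd : ∀ k z, |u k z - c| ≤ 2 * l * B * a k * √(V z.1) := fun k z => by
    have hlip' := abs_integral_pow_sub_le hρ0 hρ hτ0 hM.le hl.le (hcon z.2).1 (hcon z.2).2 hh
      (hint z.2) hlip k
    have := abs_integral_pow_sub_integral_le (hπ_inv z.2) (hintπ z.2) (hsqrt (hVπ z.2)) hρV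
      (mul_nonneg hl.le (ha0 k)) hlip' z.1
    rw [hc] at this
    refine this.trans ?_
    have hsq : ∫ x, √(V x) ∂(π z.2) ≤ B :=
      (integral_mono (hsqrt (hVπ z.2)) (hVπ z.2) fun x => sqrt_le_self_of_one_le (hV1 x)).trans
        (integral_le_of_lintegral_ofReal_le hVm hV1 hB0.le (hVπ' z.2))
    calc 2 * (l * a k) * (∫ x, √(V x) ∂(π z.2)) * √(V z.1)
        ≤ 2 * (l * a k) * B * √(V z.1) := by have := ha0 k; gcongr
      _ = _ := by ring
  have hbsum : ∀ z : S × I, Summable fun k => 2 * l * B * a k * √(V z.1) := fun z =>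
    (hasum.mul_left _).mul_right _
  have husum : ∀ z, Summable fun k => u k z - c := fun z =>
    Summable.of_norm_bounded (f := fun k => u k z - c) (hbsum z) (hubd · z)
  refine ⟨fun z => ∑' k, (u k z - c), 2 * l * B * ∑' k, a k, ?_, ?_, fun z => ?_, fun z => ?_⟩
  · have : 0 ≤ ∑' k, a k := tsum_nonneg ha0
    positivity
  · exact Measurable.tsum fun k => (humeas k).sub_const c
  · have h1 := tsum_of_norm_bounded (hbsum z).hasSum (f := fun k => u k z - c) (hubd · z)
    rwa [tsum_mul_right, tsum_mul_left] at h1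
  · have hVz : Integrable V (P z) := by
      have := hVk z.2 1 z.1
      rwa [pow_one] at this
    have hFm : ∀ k, Measurable fun y' => u k (y', z.2) - c := fun k =>
      ((humeas k).comp (measurable_id.prodMk measurable_const)).sub_const c
    have hFi : ∀ k, Integrable (fun y' => u k (y', z.2) - c) (P z) := fun k =>
      integrable_of_abs_le_sqrt (hFm k) hV1 hVz (by have := ha0 k; positivity)
        fun y' => hubd k (y', z.2)
    have hFn : Summable fun k => ∫ y', ‖u k (y', z.2) - c‖ ∂(P z) := by
      refine ((hasum.mul_left (2 * l * B)).mul_right (∫ y', √(V y') ∂(P z))).of_nonneg_of_le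
        (fun k => integral_nonneg fun _ => norm_nonneg _) fun k => ?_
      rw [← integral_const_mul]
      exact integral_mono (hFi k).norm ((hsqrt hVz).const_mul _) fun y' => hubd k (y', z.2)
    have e : ∀ k, ∫ y', (u k (y', z.2) - c) ∂(P z) = u (k + 1) z - c := fun k => by
      have hi : Integrable (fun y' => u k (y', z.2)) (P z) := by
        refine ((hFi k).add (integrable_const c)).congr (ae_of_all _ fun y' => ?_)
        simp
      rw [integral_sub hi (integrable_const c), husucc]
      simp
    rw [← (hasSum_integral_of_summable_integral_norm hFi hFn).tsum_eq]
    simp only [e]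
    rw [(husum z).tsum_eq_zero_add, hu0]
    ring

/-! ### Adaptive chains -/

theorem measurable_history {Ω S I : Type*} [MeasurableSpace S] [MeasurableSpace I]
    {Y : ℕ → Ω → S} {Γ : ℕ → Ω → I} {i n : ℕ} (hi : i ≤ n) :
    Measurable[history Y Γ n] fun ω => (Y i ω, Γ i ω) := by
  have hle : MeasurableSpace.comap (Y i) inferInstance ⊔ MeasurableSpace.comap (Γ i) inferInstance
      ≤ history Y Γ n := le_iSup₂_of_le i (Finset.mem_range.2 (by omega)) le_rfl
  exact (measurable_iff_comap_le.2 (le_sup_left.trans hle)).prodMk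
    (measurable_iff_comap_le.2 (le_sup_right.trans hle))

section Chain

variable {Ω S I : Type*} [MeasurableSpace Ω] [MeasurableSpace S] [MeasurableSpace I]
  {Pr : Measure Ω} {P : Kernel (S × I) S} {y₀ : S} {γ₀ : I} {Y : ℕ → Ω → S} {Γ : ℕ → Ω → I}

namespace IsAdaptiveChain

theorem measurable_pair (hc : IsAdaptiveChain Pr P y₀ γ₀ Y Γ) (n : ℕ) :
    Measurable fun ω => (Y n ω, Γ n ω) :=
  (hc.measurable_state n).prodMk (hc.measurable_param n)

/-- The histories `ℱ_n` as a filtration. -/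
def filtration (hc : IsAdaptiveChain Pr P y₀ γ₀ Y Γ) :
    Filtration ℕ (inferInstance : MeasurableSpace Ω) where
  seq := history Y Γ
  mono' m n hmn := biSup_mono fun i hi => by
    simp only [Finset.mem_range] at hi ⊢; omega
  le' n := iSup₂_le fun i _ =>
    sup_le (hc.measurable_state i).comap_le (hc.measurable_param i).comap_le

/-- On every event of the past, the joint law of the present and of the next state is the law of
the present composed with the kernel. -/
theorem map_restrict_eq_compProd (hc : IsAdaptiveChain Pr P y₀ γ₀ Y Γ)
    [IsProbabilityMeasure Pr] [IsMarkovKernel P] (n : ℕ) {A : Set Ω}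
    (hA : MeasurableSet[history Y Γ n] A) :
    (Pr.restrict A).map (fun ω => ((Y n ω, Γ n ω), Y (n + 1) ω))
      = (Pr.restrict A).map (fun ω => (Y n ω, Γ n ω)) ⊗ₘ P := by
  have hZ := hc.measurable_pair n
  have hY := hc.measurable_state (n + 1)
  have hle : history Y Γ n ≤ (inferInstance : MeasurableSpace Ω) := hc.filtration.le n
  have : IsFiniteMeasure ((Pr.restrict A).map (fun ω => ((Y n ω, Γ n ω), Y (n + 1) ω))) := by
    infer_instance
  refine Measure.ext_prod fun {s t} hs ht => ?_
  have hE : MeasurableSet[history Y Γ n] ((fun ω => (Y n ω, Γ n ω)) ⁻¹' s ∩ A) :=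
    (measurable_history le_rfl hs).inter hA
  set E := (fun ω => (Y n ω, Γ n ω)) ⁻¹' s ∩ A with hEdef
  have hmP : Measurable fun z : S × I => P z t := Kernel.measurable_coe P ht
  rw [Measure.map_apply (hZ.prodMk hY) (hs.prod ht), Measure.compProd_apply_prod hs ht,
    setLIntegral_map hs hmP hZ, Measure.restrict_restrict (hZ hs), ← hEdef,
    Measure.restrict_apply ((hZ.prodMk hY) (hs.prod ht))]
  have hset : (fun ω => ((Y n ω, Γ n ω), Y (n + 1) ω)) ⁻¹' s ×ˢ t ∩ A = Y (n + 1) ⁻¹' t ∩ E := by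
    ext ω
    simp only [hEdef, Set.mem_inter_iff, Set.mem_preimage, Set.mem_prod]
    tauto
  rw [hset]
  have hi : Integrable ((Y (n + 1) ⁻¹' t).indicator fun _ => (1 : ℝ)) Pr :=
    (integrable_const 1).indicator (hY ht)
  have hreal : Pr.real (Y (n + 1) ⁻¹' t ∩ E) = ∫ ω in E, (P (Y n ω, Γ n ω)).real t ∂Pr := by
    calc Pr.real (Y (n + 1) ⁻¹' t ∩ E)
        = ∫ ω in E, (Y (n + 1) ⁻¹' t).indicator (fun _ => (1 : ℝ)) ω ∂Pr := by
          rw [integral_indicator (hY ht), Measure.restrict_restrict (hY ht)]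
          simp
      _ = ∫ ω in E, (Pr[(Y (n + 1) ⁻¹' t).indicator (fun _ => (1 : ℝ)) | history Y Γ n]) ω ∂Pr :=
          (setIntegral_condExp hle hi hE).symm
      _ = ∫ ω in E, (P (Y n ω, Γ n ω)).real t ∂Pr :=
          setIntegral_congr_ae (hle _ hE) ((hc.transition n t ht).mono fun ω h _ => h)
  have hmr : Measurable fun ω => (P (Y n ω, Γ n ω)).real t := (hmP.comp hZ).ennreal_toReal
  have hir : Integrable (fun ω => (P (Y n ω, Γ n ω)).real t) (Pr.restrict E) :=
    (integrable_const (1 : ℝ)).mono' hmr.aestronglyMeasurable (ae_of_all _ fun ω => by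
      rw [Real.norm_eq_abs, abs_of_nonneg measureReal_nonneg]
      exact measureReal_le_one)
  rw [← ofReal_measureReal, hreal, ofReal_integral_eq_lintegral_ofReal hir
    (ae_of_all _ fun ω => measureReal_nonneg)]
  exact lintegral_congr fun ω => ofReal_measureReal

theorem lintegral_next (hc : IsAdaptiveChain Pr P y₀ γ₀ Y Γ)
    [IsProbabilityMeasure Pr] [IsMarkovKernel P] (n : ℕ) {F : S → ℝ≥0∞}
    (hF : Measurable F) :
    ∫⁻ ω, F (Y (n + 1) ω) ∂Pr = ∫⁻ ω, ∫⁻ y, F y ∂(P (Y n ω, Γ n ω)) ∂Pr := by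
  have hZ := hc.measurable_pair n
  have hY := hc.measurable_state (n + 1)
  have h := hc.map_restrict_eq_compProd n (A := Set.univ) MeasurableSet.univ
  rw [Measure.restrict_univ] at h
  have hF2 : Measurable fun w : (S × I) × S => F w.2 := hF.comp measurable_snd
  calc ∫⁻ ω, F (Y (n + 1) ω) ∂Pr
      = ∫⁻ z, F z.2 ∂(Pr.map (fun ω => ((Y n ω, Γ n ω), Y (n + 1) ω))) :=
        (lintegral_map hF2 (hZ.prodMk hY)).symm
    _ = _ := by
        rw [h, Measure.lintegral_compProd hF2, lintegral_map (Measurable.lintegral_kernel hF) hZ]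

/-- The moments of a common Lyapunov function along the chain are bounded. -/
theorem exists_lintegral_lyapunov_le (hc : IsAdaptiveChain Pr P y₀ γ₀ Y Γ)
    [IsProbabilityMeasure Pr] [IsMarkovKernel P] {V : S → ℝ}
    (hVm : Measurable V) (hV : IsCommonLyapunov P V) :
    ∃ R : ℝ, 0 ≤ R ∧ ∀ n, ∫⁻ ω, ENNReal.ofReal (V (Y n ω)) ∂Pr ≤ ENNReal.ofReal R := by
  obtain ⟨hV1, κ, b, hκ0, hκ1, hb, hdrift⟩ := hV
  have h1κ : 0 < 1 - κ := by linarith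
  have hV0 := hV1 y₀
  have hbκ : 0 < b / (1 - κ) := div_pos hb h1κ
  refine ⟨V y₀ + b / (1 - κ), by linarith, fun n => ?_⟩
  induction n with
  | zero =>
    simp only [hc.init_state, lintegral_const, measure_univ, mul_one]
    exact ENNReal.ofReal_le_ofReal (by linarith)
  | succ n ih =>
    rw [hc.lintegral_next n hVm.ennreal_ofReal]
    calc ∫⁻ ω, ∫⁻ y, ENNReal.ofReal (V y) ∂(P (Y n ω, Γ n ω)) ∂Pr
        ≤ ∫⁻ ω, (ENNReal.ofReal κ * ENNReal.ofReal (V (Y n ω)) + ENNReal.ofReal b) ∂Pr := by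
          refine lintegral_mono fun ω => (hdrift (Γ n ω) (Y n ω)).trans (le_of_eq ?_)
          rw [ENNReal.ofReal_add (by nlinarith [hV1 (Y n ω)]) hb.le, ENNReal.ofReal_mul hκ0.le]
      _ = ENNReal.ofReal κ * ∫⁻ ω, ENNReal.ofReal (V (Y n ω)) ∂Pr + ENNReal.ofReal b := by
          rw [lintegral_add_right _ measurable_const,
            lintegral_const_mul' _ _ ENNReal.ofReal_ne_top]
          simp
      _ ≤ ENNReal.ofReal κ * ENNReal.ofReal (V y₀ + b / (1 - κ)) + ENNReal.ofReal b := by gcongr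
      _ ≤ ENNReal.ofReal (V y₀ + b / (1 - κ)) := by
          rw [← ENNReal.ofReal_mul hκ0.le, ← ENNReal.ofReal_add (by positivity) hb.le]
          refine ENNReal.ofReal_le_ofReal ?_
          have : κ * (b / (1 - κ)) + b = b / (1 - κ) := by field_simp; ring
          nlinarith

/-- The increment of a function of the state and the parameter, centred by the kernel while the
parameter is kept, is a martingale difference. -/
theorem condExp_sub_integral_eq_zero (hc : IsAdaptiveChain Pr P y₀ γ₀ Y Γ)
    [IsProbabilityMeasure Pr] [IsMarkovKernel P] (n : ℕ)
    {g : S × I → ℝ} (hg : Measurable g) (hgP : ∀ z, Integrable (fun y => g (y, z.2)) (P z))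
    (hD : Integrable
      (fun ω => g (Y (n + 1) ω, Γ n ω) - ∫ y, g (y, Γ n ω) ∂(P (Y n ω, Γ n ω))) Pr) :
    Pr[fun ω => g (Y (n + 1) ω, Γ n ω) - ∫ y, g (y, Γ n ω) ∂(P (Y n ω, Γ n ω)) |
      hc.filtration n] =ᵐ[Pr] 0 := by
  have hZ := hc.measurable_pair n
  have hY := hc.measurable_state (n + 1)
  have hgm : Measurable fun w : (S × I) × S => g (w.2, w.1.2) :=
    hg.comp (measurable_snd.prodMk (measurable_snd.comp measurable_fst))
  have hG : Measurable fun z : S × I => ∫ y, g (y, z.2) ∂(P z) :=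
    hgm.stronglyMeasurable.integral_kernel_prod_right'.measurable
  set F : (S × I) × S → ℝ := fun w => g (w.2, w.1.2) - ∫ y, g (y, w.1.2) ∂(P w.1) with hF
  have hFm : Measurable F := hgm.sub (hG.comp measurable_fst)
  refine (ae_eq_condExp_of_forall_setIntegral_eq (hc.filtration.le n) hD
    (fun A _ _ => integrableOn_zero) (fun A hA _ => ?_) aestronglyMeasurable_zero).symm
  have hmap := hc.map_restrict_eq_compProd n hA
  have hFi : Integrable F ((Pr.restrict A).map (fun ω => (Y n ω, Γ n ω)) ⊗ₘ P) := by
    rw [← hmap, integrable_map_measure hFm.aestronglyMeasurable (hZ.prodMk hY).aemeasurable]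
    exact hD.integrableOn
  have : ∫ ω in A, F ((Y n ω, Γ n ω), Y (n + 1) ω) ∂Pr = 0 := by
    rw [← integral_map (hZ.prodMk hY).aemeasurable hFm.aestronglyMeasurable, hmap,
      Measure.integral_compProd hFi]
    refine integral_eq_zero_of_ae (ae_of_all _ fun z => ?_)
    simp only [hF, Pi.zero_apply]
    rw [integral_sub (hgP z) (integrable_const _)]
    simp
  simpa using this.symm

/-- Strong law with rate `n ^ s`, given a solution of the Poisson equations of growth `√V`: the
sums split into a martingale, the changes of the solution at the adaptation times, and a
telescoping remainder. -/
theorem ae_tendsto_sum_div_rpow (hc : IsAdaptiveChain Pr P y₀ γ₀ Y Γ)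
    [IsProbabilityMeasure Pr] [IsMarkovKernel P] {V : S → ℝ}
    (hVm : Measurable V) (hV : IsCommonLyapunov P V) {β : ℝ} (hβ : 0 < β) (hAIR : IsAIR β Γ)
    {h : S → ℝ} (hh : Measurable h) (hle : ∀ y, |h y| ≤ √(V y)) {c : ℝ}
    {g : S × I → ℝ} {C : ℝ} (hC : 0 ≤ C) (hg : Measurable g) (hgV : ∀ z, |g z| ≤ C * √(V z.1))
    (hpois : ∀ z, ∫ y, g (y, z.2) ∂(P z) = g z - (h z.1 - c))
    {s : ℝ} (hs : 1 / 2 < s) (hβs : 1 < (1 + β) * s) :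
    ∀ᵐ ω ∂Pr, Tendsto (fun n : ℕ => (∑ i ∈ Finset.range n, (h (Y (i + 1) ω) - c)) / (n : ℝ) ^ s)
      atTop (𝓝 0) := by
  obtain ⟨R, hR, hER⟩ := hc.exists_lintegral_lyapunov_le hVm hV
  obtain ⟨hV1, κ, b, hκ0, hκ1, hb, hdrift⟩ := hV
  have hs0 : 0 < s := by linarith
  -- `G z` is `P_γ g (·, γ)` at `y`, for `z = (y, γ)`.
  set G : S × I → ℝ := fun z => g z - (h z.1 - c) with hG
  have hGm : Measurable G := hg.sub ((hh.comp measurable_fst).sub_const c)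
  set C' : ℝ := C + 1 + |c| with hC'
  have hC'0 : 0 ≤ C' := by positivity
  have hVs : ∀ y, 1 ≤ √(V y) := fun y => Real.one_le_sqrt.2 (hV1 y)
  have hGV : ∀ z, |G z| ≤ C' * √(V z.1) := fun z => by
    have h1 : |G z| ≤ |g z| + (|h z.1| + |c|) :=
      (abs_sub _ _).trans (add_le_add_right (abs_sub _ _) _)
    have h2 := hgV z
    have h3 := hle z.1
    have h4 : |c| ≤ |c| * √(V z.1) := le_mul_of_one_le_right (abs_nonneg c) (hVs z.1)
    rw [hC']; linarith
  have hgP : ∀ z, Integrable (fun y => g (y, z.2)) (P z) := fun z =>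
    integrable_of_abs_le_sqrt (hg.comp (measurable_id.prodMk measurable_const)) hV1
      (integrable_of_lintegral_ofReal_le hVm hV1 (hdrift z.2 z.1)) hC fun y => hgV (y, z.2)
  have hVY : ∀ n, Integrable (fun ω => V (Y n ω)) Pr := fun n =>
    integrable_of_lintegral_ofReal_le (hVm.comp (hc.measurable_state n))
      (fun ω => hV1 (Y n ω)) (hER n)
  have hVYR : ∀ n, ∫ ω, V (Y n ω) ∂Pr ≤ R := fun n =>
    integral_le_of_lintegral_ofReal_le (hVm.comp (hc.measurable_state n))
      (fun ω => hV1 (Y n ω)) hR (hER n)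
  -- the martingale part
  set D : ℕ → Ω → ℝ := fun i ω => g (Y (i + 1) ω, Γ i ω) - G (Y i ω, Γ i ω) with hD
  have hDm : ∀ i, Measurable[hc.filtration (i + 1)] (D i) := fun i => by
    have m1 : Measurable[hc.filtration (i + 1)] fun ω => (Y (i + 1) ω, Γ (i + 1) ω) :=
      measurable_history le_rfl
    have m0 : Measurable[hc.filtration (i + 1)] fun ω => (Y i ω, Γ i ω) :=
      measurable_history i.le_succ
    exact (hg.comp (m1.fst.prodMk m0.snd)).sub (hGm.comp m0)
  have hDm' : ∀ i, Measurable (D i) := fun i => (hDm i).mono (hc.filtration.le _) le_rfl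
  have hDsq : ∀ i ω, D i ω ^ 2 ≤ 2 * C' ^ 2 * (V (Y (i + 1) ω) + V (Y i ω)) := fun i ω => by
    have h1 : |g (Y (i + 1) ω, Γ i ω)| ≤ C' * √(V (Y (i + 1) ω)) :=
      (hgV _).trans (mul_le_mul_of_nonneg_right
        (by rw [hC']; linarith [abs_nonneg c]) (Real.sqrt_nonneg _))
    have h2 := hGV (Y i ω, Γ i ω)
    have s1 := Real.sq_sqrt (zero_le_one.trans (hV1 (Y (i + 1) ω)))
    have s2 := Real.sq_sqrt (zero_le_one.trans (hV1 (Y i ω)))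
    have q1 := pow_le_pow_left₀ (abs_nonneg _) h1 2
    have q2 := pow_le_pow_left₀ (abs_nonneg _) h2 2
    rw [sq_abs, mul_pow, s1] at q1
    rw [sq_abs, mul_pow, s2] at q2
    have := sq_nonneg (g (Y (i + 1) ω, Γ i ω) + G (Y i ω, Γ i ω))
    simp only [hD]
    nlinarith
  have hDsqi : ∀ i, Integrable (fun ω => D i ω ^ 2) Pr := fun i =>
    (((hVY (i + 1)).add (hVY i)).const_mul (2 * C' ^ 2)).mono'
      ((hDm' i).pow_const 2).aestronglyMeasurable (ae_of_all _ fun ω => by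
        rw [Real.norm_eq_abs, abs_of_nonneg (sq_nonneg _)]
        exact hDsq i ω)
  have hDL2 : ∀ i, MemLp (D i) 2 Pr := fun i =>
    (memLp_two_iff_integrable_sq (hDm' i).aestronglyMeasurable).2 (hDsqi i)
  have hDR : ∀ i, ∫ ω, D i ω ^ 2 ∂Pr ≤ 2 * C' ^ 2 * (R + R) := fun i => by
    calc ∫ ω, D i ω ^ 2 ∂Pr ≤ ∫ ω, 2 * C' ^ 2 * (V (Y (i + 1) ω) + V (Y i ω)) ∂Pr :=
          integral_mono (hDsqi i) (((hVY (i + 1)).add (hVY i)).const_mul _) (hDsq i)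
      _ = 2 * C' ^ 2 * (∫ ω, V (Y (i + 1) ω) ∂Pr + ∫ ω, V (Y i ω) ∂Pr) := by
          rw [integral_const_mul, integral_add (hVY _) (hVY _)]
      _ ≤ _ := by
          have h1 := hVYR (i + 1)
          have h2 := hVYR i
          gcongr
  have hDcond : ∀ i, Pr[D i | hc.filtration i] =ᵐ[Pr] 0 := fun i => by
    have e : D i = fun ω => g (Y (i + 1) ω, Γ i ω) - ∫ y, g (y, Γ i ω) ∂(P (Y i ω, Γ i ω)) := by
      ext ω
      simp only [hD, hG]
      rw [hpois (Y i ω, Γ i ω)]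
    have hint := (hDL2 i).integrable one_le_two
    rw [e] at hint ⊢
    exact hc.condExp_sub_integral_eq_zero i hg hgP hint
  set w : ℕ → ℝ := fun i => 1 / ((i + 1 : ℕ) : ℝ) ^ s with hw
  have hw0 : ∀ i, 0 ≤ w i := fun i => by positivity
  have hwsq : Summable fun i => w i ^ 2 := by
    have h2s : 1 < 2 * s := by linarith
    refine ((summable_nat_add_iff 1).2 (Real.summable_one_div_nat_rpow.2 h2s)).congr fun i => ?_
    rw [hw, div_pow, one_pow, ← Real.rpow_mul_natCast (by positivity)]
    norm_num [mul_comm]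
  have hmart := ae_exists_tendsto_sum_of_martingale_difference hc.filtration
    (D := fun i ω => w i * D i ω) (fun i => ((hDm i).const_mul (w i)).stronglyMeasurable)
    (fun i => (hDL2 i).const_mul (w i))
    (fun i => by
      have h1 := condExp_smul (μ := Pr) (w i) (D i) (hc.filtration i)
      filter_upwards [h1, hDcond i] with ω h2 h3
      have e : (fun ω => w i * D i ω) = w i • D i := rfl
      rw [e, h2, Pi.smul_apply, h3]; simp)
    (by
      refine (hwsq.mul_right (2 * C' ^ 2 * (R + R))).of_nonneg_of_le
        (fun i => integral_nonneg fun ω => sq_nonneg _) fun i => ?_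
      simp only [mul_pow]
      rw [integral_const_mul]
      exact mul_le_mul_of_nonneg_left (hDR i) (sq_nonneg _))
  -- the changes of the parameter
  have hjump := ae_summable_of_lintegral_le (μ := Pr) (F := fun i ω => V (Y (i + 1) ω))
    (fun i => hVm.comp (hc.measurable_state (i + 1)))
    (fun i ω => zero_le_one.trans (hV1 _)) (fun i => hER (i + 1))
    (w := fun i : ℕ => (Set.range (adaptationTime β)).indicator
      (fun k : ℕ => 1 / (k : ℝ) ^ s) (i + 1))
    (fun i => Set.indicator_nonneg (fun _ _ => by positivity) _)
    (summable_indicator_adaptationTime hβ hs0 hβs)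
  -- the telescoping remainder
  have hrem := ae_summable_of_lintegral_le (μ := Pr) (F := fun i ω => V (Y i ω))
    (fun i => hVm.comp (hc.measurable_state i))
    (fun i ω => zero_le_one.trans (hV1 _)) hER
    (w := fun n : ℕ => 1 / (n : ℝ) ^ (2 * s)) (fun n => by positivity)
    (Real.summable_one_div_nat_rpow.2 (by linarith))
  filter_upwards [hmart, hjump, hrem] with ω ⟨L, hL⟩ hωjump hωrem
  set E : ℕ → ℝ := fun i => g (Y (i + 1) ω, Γ (i + 1) ω) - g (Y (i + 1) ω, Γ i ω) with hE
  have hEsum : Summable fun i => w i * E i := by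
    refine Summable.of_norm_bounded (hωjump.mul_left (2 * C)) fun i => ?_
    by_cases hi : i + 1 ∈ Set.range (adaptationTime β)
    · rw [Set.indicator_of_mem hi, Real.norm_eq_abs, abs_mul, abs_of_nonneg (hw0 i)]
      have hE2 : |E i| ≤ 2 * C * V (Y (i + 1) ω) := by
        have h1 := hgV (Y (i + 1) ω, Γ (i + 1) ω)
        have h2 := hgV (Y (i + 1) ω, Γ i ω)
        have h3 := mul_le_mul_of_nonneg_left (sqrt_le_self_of_one_le (hV1 (Y (i + 1) ω))) hC
        have h4 : |E i| ≤ _ := abs_sub _ _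
        dsimp only at h1 h2
        linarith
      calc w i * |E i| ≤ w i * (2 * C * V (Y (i + 1) ω)) :=
            mul_le_mul_of_nonneg_left hE2 (hw0 i)
        _ = _ := by simp only [hw]; ring
    · have : E i = 0 := by simp only [hE, hAIR.param_succ_eq hi ω, sub_self]
      rw [this, Set.indicator_of_notMem hi]
      simp
  have hsumlim := hL.add hEsum.hasSum.tendsto_sum_nat
  simp only [← Finset.sum_add_distrib] at hsumlim
  have hpow_top : Tendsto (fun n : ℕ => (n : ℝ) ^ s) atTop atTop :=
    (tendsto_rpow_atTop hs0).comp tendsto_natCast_atTop_atTop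
  have hkron := kronecker_lemma (w := fun n : ℕ => (n : ℝ) ^ s)
    (fun m n hmn => by dsimp only; gcongr) hpow_top hsumlim
  have hGn : Tendsto (fun n : ℕ => G (Y n ω, Γ n ω) / (n : ℝ) ^ s) atTop (𝓝 0) := by
    have h1 := (hωrem.tendsto_atTop_zero.sqrt).const_mul C'
    rw [Real.sqrt_zero, mul_zero] at h1
    refine squeeze_zero_norm (fun n => ?_) h1
    have hns : (0 : ℝ) ≤ (n : ℝ) ^ s := by positivity
    have e : (n : ℝ) ^ (2 * s) = ((n : ℝ) ^ s) ^ 2 := by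
      rw [← Real.rpow_mul_natCast (by positivity)]; norm_num [mul_comm]
    rw [Real.norm_eq_abs, abs_div, abs_of_nonneg hns, e, one_div_mul_eq_div,
      Real.sqrt_div (zero_le_one.trans (hV1 _)), Real.sqrt_sq hns, mul_div_assoc']
    exact div_le_div_of_nonneg_right (hGV (Y n ω, Γ n ω)) hns
  have hG0 : Tendsto (fun n : ℕ => G (Y 0 ω, Γ 0 ω) / (n : ℝ) ^ s) atTop (𝓝 0) :=
    tendsto_const_nhds.div_atTop hpow_top
  have hfin := (hkron.add hG0).sub hGn
  simp only [add_zero, sub_zero] at hfin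
  refine hfin.congr fun n => ?_
  rw [← add_div, ← sub_div]
  congr 1
  -- the Poisson equation makes `h (Y (i + 1)) - c = D i + E i + G (Z i) - G (Z (i + 1))` for
  -- `Z i = (Y i, Γ i)`, and the last two terms telescope
  have hterm : ∀ i, ((i + 1 : ℕ) : ℝ) ^ s * (w i * D i ω + w i * E i) = D i ω + E i := fun i => by
    have : (0 : ℝ) < ((i + 1 : ℕ) : ℝ) ^ s := by positivity
    simp only [hw]
    field_simp
  simp only [hterm]
  induction n with
  | zero => simp
  | succ n ih =>
    rw [Finset.sum_range_succ, Finset.sum_range_succ, ← ih]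
    simp only [hD, hE, hG]
    ring

end IsAdaptiveChain

end Chain

/-! ### The weighted distance -/

theorem weightedDist_pos {A : Type*} [TopologicalSpace A] {d : A → A → ℝ} (hd : IsDistanceLike d)
    {V : A → ℝ} (hV : ∀ y, 1 ≤ V y) (q : ℝ) {x y : A} (hxy : x ≠ y) :
    0 < weightedDist d V q x y := by
  have h1 : 0 < d x y := (hd.nonneg x y).lt_of_ne' fun h => hxy ((hd.eq_zero_iff x y).1 h)
  have h2 : 0 ≤ V x ^ q := Real.rpow_nonneg (zero_le_one.trans (hV x)) q
  have h3 : 0 ≤ V y ^ q := Real.rpow_nonneg (zero_le_one.trans (hV y)) q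
  exact Real.sqrt_pos.2 (mul_pos h1 (by linarith))

theorem weightedDist_le {A : Type*} {d : A → A → ℝ} (hd : ∀ x y, d x y ≤ 1)
    {V : A → ℝ} (hV : ∀ y, 1 ≤ V y) {q : ℝ} (hq : q ≤ 1) (x y : A) :
    weightedDist d V q x y ≤ 2 * √(V x) * √(V y) := by
  have hle : ∀ z, V z ^ q ≤ V z := fun z => by
    simpa using Real.rpow_le_rpow_of_exponent_le (hV z) hq
  have h0 : ∀ z, 0 ≤ V z ^ q := fun z => Real.rpow_nonneg (zero_le_one.trans (hV z)) q
  refine Real.sqrt_le_iff.2 ⟨by positivity, ?_⟩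
  rw [mul_pow, mul_pow, Real.sq_sqrt (zero_le_one.trans (hV x)),
    Real.sq_sqrt (zero_le_one.trans (hV y))]
  have h1 := mul_le_mul_of_nonneg_right (hd x y)
    (by linarith [h0 x, h0 y] : 0 ≤ 1 + V x ^ q + V y ^ q)
  nlinarith [hle x, hle y, hV x, hV y, mul_nonneg (sub_nonneg.2 (hV x)) (sub_nonneg.2 (hV y))]

end AirMCMC

theorem mainTheorem9
    {X Φ I Ω : Type*}
    [TopologicalSpace X] [PolishSpace X] [MeasurableSpace X] [BorelSpace X]
    [TopologicalSpace Φ] [PolishSpace Φ] [MeasurableSpace Φ] [BorelSpace Φ]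
    [MeasurableSpace I] [MeasurableSpace Ω]
    (Pr : Measure Ω) [IsProbabilityMeasure Pr]
    -- the target, the kernels, and their invariant distributions, all with `X`-marginal `ν`
    (ν : Measure X) [IsProbabilityMeasure ν]
    (P : Kernel ((X × Φ) × I) (X × Φ)) [IsMarkovKernel P]
    (π : I → Measure (X × Φ)) (hπ_prob : ∀ γ, IsProbabilityMeasure (π γ))
    (hπ_inv : ∀ γ, Kernel.Invariant (AirMCMC.kernelAt P γ) (π γ))
    (hπ_marg : ∀ γ, (π γ).map Prod.fst = ν)
    -- the AIR chain
    (β : ℝ) (hβ : 0 < β)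
    (y₀ : X × Φ) (γ₀ : I) (Y : ℕ → Ω → X × Φ) (Γ : ℕ → Ω → I)
    (hchain : AirMCMC.IsAdaptiveChain Pr P y₀ γ₀ Y Γ)
    (hAIR : AirMCMC.IsAIR β Γ)
    -- the distance-like function and the Lyapunov function
    (d : X × Φ → X × Φ → ℝ) (hd : AirMCMC.IsDistanceLike d) (hd_le : ∀ y₁ y₂, d y₁ y₂ ≤ 1)
    (V : X × Φ → ℝ) (hV_lsc : LowerSemicontinuous V) (hV : AirMCMC.IsCommonLyapunov P V)
    -- the contraction
    (p : ℝ) (hp : 2 < p)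
    (hcontr : AirMCMC.UniformContraction (AirMCMC.weightedDist d V (1 / p)) P)
    -- the integrand
    (f : X → ℝ) (hf : Measurable f)
    (hf_lip : AirMCMC.IsLipschitzWrt (AirMCMC.weightedDist d V (1 / p)) (fun y => f y.1))
    (hf_le : ∀ y : X × Φ, |f y.1| ≤ V y ^ (1 / p))
    (ε : ℝ) (hε : max 0 (1 / (1 + β) + 1 / p - 1 / 2) < ε) :
    Integrable f ν ∧
      ∀ᵐ ω ∂Pr, Tendsto
        (fun n : ℕ => 1 / (n : ℝ) ^ (1 / 2 + ε) *
          ∑ j ∈ Finset.Icc 1 n, (f (Y j ω).1 - ∫ x, f x ∂ν))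
        atTop (𝓝 0) := by
  have hVm : Measurable V := hV_lsc.measurable
  have hV1 := hV.1
  have hp0 : 0 < 1 / p := by positivity
  have hp1 : 1 / p < 1 / 2 := one_div_lt_one_div_of_lt two_pos hp
  have hle : ∀ y : X × Φ, |f y.1| ≤ √(V y) := fun y => by
    rw [Real.sqrt_eq_rpow]
    exact (hf_le y).trans (Real.rpow_le_rpow_of_exponent_le (hV1 y) hp1.le)
  have hh : Measurable fun y : X × Φ => f y.1 := hf.comp measurable_fst
  have hmean : ∀ γ, ∫ y, f y.1 ∂(π γ) = ∫ x, f x ∂ν := fun γ => by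
    rw [← hπ_marg γ, integral_map measurable_fst.aemeasurable hf.aestronglyMeasurable]
  have hint : Integrable f ν := by
    obtain ⟨-, κ, b, hκ0, hκ1, hb, hdrift⟩ := hV
    have : IsMarkovKernel (AirMCMC.kernelAt P γ₀) := by unfold AirMCMC.kernelAt; infer_instance
    have hVi : Integrable V (π γ₀) := AirMCMC.integrable_of_lintegral_ofReal_le hVm hV1
      (AirMCMC.lintegral_invariant_le_of_drift (hπ_inv γ₀) hVm hV1 hκ0 hκ1 hb (hdrift γ₀))
    rw [← hπ_marg γ₀, integrable_map_measure hf.aestronglyMeasurable measurable_fst.aemeasurable]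
    exact AirMCMC.integrable_of_abs_le_sqrt hh hV1 hVi zero_le_one fun y => by
      rw [one_mul]; exact hle y
  refine ⟨hint, ?_⟩
  obtain ⟨g, C, hC, hg, hgV, hpois⟩ := AirMCMC.exists_poisson_solution hπ_prob hπ_inv hVm hV
    (fun _ _ => Real.sqrt_nonneg _) (fun _ _ => AirMCMC.weightedDist_pos hd hV1 (1 / p))
    (AirMCMC.weightedDist_le hd_le hV1 (by linarith)) hcontr hh hle hf_lip hmean
  have hs : 1 / 2 < 1 / 2 + ε := by linarith [le_max_left 0 (1 / (1 + β) + 1 / p - 1 / 2)]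
  have hβs : 1 < (1 + β) * (1 / 2 + ε) := by
    have h1 : 1 / (1 + β) < 1 / 2 + ε := by
      linarith [le_max_right 0 (1 / (1 + β) + 1 / p - 1 / 2)]
    rwa [div_lt_iff₀' (by linarith)] at h1
  filter_upwards [hchain.ae_tendsto_sum_div_rpow hVm hV hβ hAIR hh hle hC hg hgV hpois hs hβs]
    with ω hω
  refine hω.congr fun n => ?_
  rw [one_div_mul_eq_div, Finset.range_eq_Ico, Finset.sum_Ico_add' (fun j => f (Y j ω).1 - _)]
  rfl
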